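/- Notation. A partition of $[a,b]$ is a finite sequence $a=t_0<t_1<\dots<t_n=b$ with mesh $\max_i (t_i-t_{i-1})$; it is tagged if points $u_i\in[t_{i-1},t_i]$, $1\le i\le n$, are given. For $1\le q<\infty$ and a real function $f$ on $[a,b]$, let $$V_q(f;[a,b])=\sup\Big(\sum_{i=1}^n|f(t_i)-f(t_{i-1})|^q\Big)^{1/q},$$ the supremum being over all partitions of $[a,b]$. Write $f\in\mathcal W_q[a,b]$ if $V_q(f;[a,b])<\infty$, and $f\in\mathcal W_\infty[a,b]$ if $f$ is regulated, i.e. has left limits at each point of $(a,b]$ and right limits at each point of $[a,b)$. For $1\le p<\infty$ and a real function $G$ on $[a,b]\times[c,d]$, let $$V_p(G;[a,b]\times[c,d])=\sup\Big(\sum_{i=1}^n\sum_{j=1}^m|G(s_i,t_j)-G(s_{i-1},t_j)-G(s_i,t_{j-1})+G(s_{i-1},t_{j-1})|^p\Big)^{1/p},$$ the supremum being over all partitions $(s_i)_{0\le i\le n}$ of $[a,b]$ and $(t_j)_{0\le j\le m}$ of $[c,d]$. Let $\mathcal Q_p=[1,p/(p-1))$ if $p>1$ and $\mathcal Q_1=\{\infty\}$.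 A second order process $X$ on $[0,T]$ is a family of real random variables $X(t)$, $t\in[0,T]$, on a probability space, with $E[X(t)^2]<\infty$; its covariance function is $\Gamma_X(s,t)=E[X(s)X(t)]$. The quadratic mean (q.m.) Riemann–Stieltjes integral $\int_a^b f\,dX$ exists and equals $I\in L^2$ if for each $\varepsilon>0$ there is $\delta>0$ such that $$E\Big[\sum_{i=1}^n f(u_i)\,(X(t_i)-X(t_{i-1}))-I\Big]^2<\varepsilon$$ for every tagged partition of $[a,b]$ with mesh less than $\delta$ (for $a=b$ the integral is $0$). Theorem 2.5. Let $0<T<\infty$ and $p\ge 1$, and let $f\in\mathcal W_q[0,T]$ for some $q\in\mathcal Q_p$. There is a finite constant $K=K(p,f)$, depending only on $p$ and $f$ (in particular not on the process or on $s,t$ below), such that for every second order process $X$ on $[0,T]$ whose covariance function $\Gamma_X$ is continuous on $[0,T]^2$ and satisfies $V_p(\Gamma_X;[0,T]^2)<\infty$, the following hold: 1. for each $t\in[0,T]$ the q.m. Riemann–Stieltjes integral $\int_0^t f\,dX$ exists; 2. for all $0\le s<t\le T$ the q.m. Riemann–Stieltjes integral $\int_s^t f\,dX$ exists and $$E\Big[\int_s^t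 f\,dX\Big]^2\le K\,V_p(\Gamma_X;[s,t]^2).$$ -/

import Mathlib

open MeasureTheory Set Filter Topology
open scoped ENNReal

namespace QMStieltjes

/-- A partition `a = t₀ < t₁ < ⋯ < tₙ = b` of the interval `[a, b]`
(for `a = b` the only one is the one-point sequence, with `n = 0`). -/
structure IntervalPartition (a b : ℝ) where
  n : ℕ
  pt : Fin (n + 1) → ℝ
  strictMono : StrictMono pt
  pt_first : pt 0 = a
  pt_last : pt (Fin.last n) = b

/-- The mesh `max_i (t_i - t_{i-1})` (equal to `0` when there are no subintervals). -/
noncomputable def IntervalPartition.mesh {a b : ℝ} (κ : IntervalPartition a b) : ℝ :=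
  ⨆ i : Fin κ.n, (κ.pt i.succ - κ.pt i.castSucc)

/-- A tagged partition: a partition with a tag `u_i ∈ [t_{i-1}, t_i]` in each subinterval. -/
structure TaggedIntervalPartition (a b : ℝ) extends IntervalPartition a b where
  tag : Fin n → ℝ
  tag_mem : ∀ i : Fin n, tag i ∈ Icc (pt i.castSucc) (pt i.succ)

/-- `V_p(f; [a, b])`, the supremum over partitions of `(∑ |f(t_i) - f(t_{i-1})|^p)^{1/p}`,
as an extended nonnegative number. -/
noncomputable def pVar (p : ℝ) (f : ℝ → ℝ) (a b : ℝ) : ℝ≥0∞ :=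
  ⨆ κ : IntervalPartition a b,
    ENNReal.ofReal
      ((∑ i : Fin κ.n, |f (κ.pt i.succ) - f (κ.pt i.castSucc)| ^ p) ^ (1 / p))

/-- The function `f` is regulated on `[a, b]`. -/
def IsRegulatedOn (f : ℝ → ℝ) (a b : ℝ) : Prop :=
  (∀ x ∈ Ioc a b, ∃ l : ℝ, Tendsto f (𝓝[<] x) (𝓝 l)) ∧
  (∀ x ∈ Ico a b, ∃ r : ℝ, Tendsto f (𝓝[>] x) (𝓝 r))

/-- The class `W_q[a, b]`, `1 ≤ q ≤ ∞`: bounded `q`-variation on `[a, b]` if `q < ∞`,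
and regulated on `[a, b]` if `q = ∞`. -/
def MemW (q : ℝ≥0∞) (f : ℝ → ℝ) (a b : ℝ) : Prop :=
  (q = ∞ ∧ IsRegulatedOn f a b) ∨ (q ≠ ∞ ∧ pVar q.toReal f a b < ∞)

/-- The exponents `Q_p = [1, p/(p-1))` for `p > 1`, and `Q_1 = {∞}`. -/
def Q (p : ℝ) : Set ℝ≥0∞ :=
  {q | (p = 1 ∧ q = ∞) ∨ (1 < p ∧ 1 ≤ q ∧ q < ENNReal.ofReal (p / (p - 1)))}

/-- The double increment of `G` over the rectangle `[s, s'] × [t, t']`. -/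
def doubleIncrement (G : ℝ → ℝ → ℝ) (s s' t t' : ℝ) : ℝ :=
  G s' t' - G s t' - G s' t + G s t

/-- `V_p(G; [a, b] × [c, d])`, the supremum over grid partitions of
`(∑_i ∑_j |Δ_{i,j} G|^p)^{1/p}`, as an extended nonnegative number. -/
noncomputable def pVar₂ (p : ℝ) (G : ℝ → ℝ → ℝ) (a b c d : ℝ) : ℝ≥0∞ :=
  ⨆ (κ : IntervalPartition a b) (η : IntervalPartition c d),
    ENNReal.ofReal
      ((∑ i : Fin κ.n, ∑ j : Fin η.n,
        |doubleIncrement G (κ.pt i.castSucc) (κ.pt i.succ)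
          (η.pt j.castSucc) (η.pt j.succ)| ^ p) ^ (1 / p))

variable {Ω : Type*} [MeasurableSpace Ω]

/-- `X` is a second order process on `[0, T]`: each `X(t)` is a random variable with finite
second moment. -/
def IsSecondOrder (X : ℝ → Ω → ℝ) (μ : Measure Ω) (T : ℝ) : Prop :=
  ∀ t ∈ Icc 0 T, MemLp (X t) 2 μ

/-- The covariance function `Γ_X(s, t) = E[X(s) X(t)]`. -/
noncomputable def covFun (X : ℝ → Ω → ℝ) (μ : Measure Ω) (s t : ℝ) : ℝ :=
  ∫ ω, X s ω * X t ω ∂μ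

/-- The Riemann–Stieltjes sum `∑ f(u_i) (X(t_i) - X(t_{i-1}))`. -/
noncomputable def rsSum (f : ℝ → ℝ) (X : ℝ → Ω → ℝ) {a b : ℝ}
    (κ : TaggedIntervalPartition a b) (ω : Ω) : ℝ :=
  ∑ i : Fin κ.n, f (κ.tag i) * (X (κ.pt i.succ) ω - X (κ.pt i.castSucc) ω)

/-- The quadratic mean Riemann–Stieltjes integral over `[a, b]` of `f` with respect to `X`
exists and equals the square integrable random variable `I`. -/
def HasQMIntegral (f : ℝ → ℝ) (X : ℝ → Ω → ℝ) (μ : Measure Ω) (a b : ℝ) (I : Ω → ℝ) : Prop :=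
  MemLp I 2 μ ∧
    ∀ ε : ℝ, 0 < ε → ∃ δ : ℝ, 0 < δ ∧ ∀ κ : TaggedIntervalPartition a b,
      κ.mesh < δ → ∫ ω, (rsSum f X κ ω - I ω) ^ 2 ∂μ < ε

end QMStieltjes

/-! A second order process is a curve `Y` in the Hilbert space L², with Γ(s,t) = ⟨Y s, Y t⟩, and
q.m. integrals are limits in L² of sums ∑ f(u_i)(Y(t_i) − Y(t_{i-1})).

If `g` takes at most N+1 values on consecutive blocks and |g| ≤ c, every Riemann–Stieltjes sum of
`g` collapses to N+1 increments of `Y`. Its squared norm is a double sum of covariance increments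
with coefficients at most c². Hölder's inequality over the (N+1)² pairs bounds it by c²
(N+1)^{2(1−1/p)} V_p(Γ), however fine the partition (`IsStep.norm_vecSum_le`).

Now approximate `f` uniformly by steps g_k with N_k levels and error e_k, and telescope over g_{k+1}
− g_k (`StepApprox.dist_vecSum_le`). Everything is uniform in the partition once ∑ (e_k + e_{k+1})
(N_{k+1} + N_k + 1)^{1−1/p} < ∞. For p = 1 the exponent is 0 and any regulated `f` qualifies. For p
> 1, quantising the q-variation of `f` at scale 2^{-k} gives N_k ≈ 2^k and e_k = 2^{-k/q}, which is
summable because q < p/(p−1) means 1 − 1/p < 1/q.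

Continuity of Γ makes `Y` continuous, so step functions are integrable (`IsStep.exists_tendsto`),
and the uniform approximation carries this to `f`. -/

namespace QMStieltjes

/-! ### Partitions, monotone sequences and variation sums -/

section Partitions

/-- Sums over the increments of a monotone sequence are sums over a genuine partition. -/
theorem exists_partition_of_monotone (τ : ℕ → ℝ) (hτ : Monotone τ) (M : ℕ) :
    ∃ κ : IntervalPartition (τ 0) (τ M), ∀ h : ℝ → ℝ → ℝ, (∀ x, h x x = 0) →
      ∑ i : Fin κ.n, h (κ.pt i.castSucc) (κ.pt i.succ) =
        ∑ m ∈ Finset.range M, h (τ m) (τ (m + 1)) := by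
  induction M with
  | zero =>
    exact ⟨⟨0, fun _ => τ 0, fun i j h => absurd h (by have := i.2; have := j.2; rw [Fin.lt_def]; omega), rfl, rfl⟩, fun h _ => by simp⟩
  | succ M ih =>
    obtain ⟨κ, hκ⟩ := ih
    -- A repeated point adds no division point, and its term is h x x = 0.
    rcases (hτ (Nat.le_succ M)).eq_or_lt with e | e
    · rw [← e]
      refine ⟨κ, fun h h0 => ?_⟩
      rw [hκ h h0, Finset.sum_range_succ, ← e, h0, add_zero]
    · refine ⟨⟨κ.n + 1, Fin.snoc (α := fun _ => ℝ) κ.pt (τ (M + 1)), ?_, ?_, ?_⟩, fun h h0 => ?_⟩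
      · refine Fin.strictMono_iff_lt_succ.2 fun i => ?_
        refine Fin.lastCases ?_ (fun j => ?_) i
        · rw [Fin.snoc_castSucc, Fin.succ_last, Fin.snoc_last, κ.pt_last]
          exact e
        · rw [Fin.snoc_castSucc, Fin.succ_castSucc, Fin.snoc_castSucc]
          exact κ.strictMono Fin.castSucc_lt_succ
      · rw [← Fin.castSucc_zero, Fin.snoc_castSucc, κ.pt_first]
      · rw [Fin.snoc_last]
      · rw [Finset.sum_range_succ, ← hκ h h0, Fin.sum_univ_castSucc]
        simp only [Fin.snoc_castSucc, Fin.succ_castSucc, Fin.succ_last, Fin.snoc_last, κ.pt_last]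

/-- The sums over a monotone sequence in `[a, b]` are dominated by sums over a partition. -/
theorem exists_partition_sum_le {a b : ℝ} (τ : ℕ → ℝ) (hτ : Monotone τ)
    (hab : ∀ i, τ i ∈ Icc a b) (M : ℕ) :
    ∃ κ : IntervalPartition a b, ∀ h : ℝ → ℝ → ℝ, (∀ x, h x x = 0) → (∀ x y, 0 ≤ h x y) →
      ∑ m ∈ Finset.range M, h (τ m) (τ (m + 1)) ≤
        ∑ i : Fin κ.n, h (κ.pt i.castSucc) (κ.pt i.succ) := by
  -- `τ 0, …, τ M` with `a` put in front and `b` behind; the two extra terms are nonnegative.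
  let σ : ℕ → ℝ := fun i => if i = 0 then a else if i ≤ M + 1 then τ (i - 1) else b
  have hσ : Monotone σ := by
    refine monotone_nat_of_le_succ fun i => ?_
    have h1 := hab (i - 1)
    have h2 := hab i
    have h3 := hτ (Nat.sub_le i 1)
    simp only [σ, Nat.add_sub_cancel]
    split_ifs <;>
      first | (exfalso; omega) | exact h2.1 | exact h1.2 | exact h3 | exact le_rfl
  obtain ⟨κ, hκ⟩ := exists_partition_of_monotone σ hσ (M + 2)
  have h0 : σ 0 = a := by simp [σ]
  have h1 : σ (M + 2) = b := by simp [σ]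
  revert κ
  rw [h0, h1]
  intro κ hκ
  refine ⟨κ, fun h hx hn => ?_⟩
  rw [hκ h hx, Finset.sum_range_succ, Finset.sum_range_succ']
  have e : ∀ m ∈ Finset.range M, h (τ m) (τ (m + 1)) = h (σ (m + 1)) (σ (m + 1 + 1)) := by
    intro m hm
    have := Finset.mem_range.1 hm
    simp only [σ]
    rw [if_neg (by omega), if_pos (by omega), if_neg (by omega), if_pos (by omega)]
    simp
  rw [Finset.sum_congr rfl e]
  have := hn (σ 0) (σ (0 + 1))
  have := hn (σ (M + 1)) (σ (M + 1 + 1))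
  linarith

theorem sum_rpow_le_pVar {q : ℝ} (hq : 0 < q) {f : ℝ → ℝ} {a b : ℝ} (τ : ℕ → ℝ)
    (hτ : Monotone τ) (hab : ∀ i, τ i ∈ Icc a b) (M : ℕ) (hV : pVar q f a b < ∞) :
    ∑ m ∈ Finset.range M, |f (τ (m + 1)) - f (τ m)| ^ q ≤ (pVar q f a b).toReal ^ q := by
  obtain ⟨κ, hκ⟩ := exists_partition_sum_le τ hτ hab M
  have h1 := hκ (fun x y => |f y - f x| ^ q) (fun x => by simp [hq.ne']) fun x y => by positivity
  have h2 : ENNReal.ofReal ((∑ i : Fin κ.n, |f (κ.pt i.succ) - f (κ.pt i.castSucc)| ^ q) ^ (1 / q))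
      ≤ pVar q f a b := le_iSup (fun κ : IntervalPartition a b => ENNReal.ofReal
      ((∑ i : Fin κ.n, |f (κ.pt i.succ) - f (κ.pt i.castSucc)| ^ q) ^ (1 / q))) κ
  rw [ENNReal.ofReal_le_iff_le_toReal hV.ne] at h2
  refine h1.trans ?_
  have h3 := Real.rpow_le_rpow (by positivity) h2 hq.le
  rwa [← Real.rpow_mul (by positivity), one_div_mul_cancel hq.ne', Real.rpow_one] at h3

/-- The comparison of sequences with partitions is applied in one variable at a time, the other
being frozen. -/
theorem rpow_sum_le_pVar₂ {p : ℝ} (hp : 0 < p) {G : ℝ → ℝ → ℝ} {a b : ℝ} (τ : ℕ → ℝ)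
    (hτ : Monotone τ) (hab : ∀ i, τ i ∈ Icc a b) (M : ℕ) :
    ENNReal.ofReal ((∑ m ∈ Finset.range M, ∑ k ∈ Finset.range M,
      |doubleIncrement G (τ m) (τ (m + 1)) (τ k) (τ (k + 1))| ^ p) ^ (1 / p)) ≤
      pVar₂ p G a b a b := by
  obtain ⟨κ, hκ⟩ := exists_partition_sum_le τ hτ hab M
  refine le_trans (ENNReal.ofReal_le_ofReal (Real.rpow_le_rpow (by positivity) ?_ (by positivity)))
    (le_iSup₂ (f := fun (κ η : IntervalPartition a b) => ENNReal.ofReal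
      ((∑ i : Fin κ.n, ∑ j : Fin η.n,
        |doubleIncrement G (κ.pt i.castSucc) (κ.pt i.succ)
          (η.pt j.castSucc) (η.pt j.succ)| ^ p) ^ (1 / p))) κ κ)
  refine le_trans (Finset.sum_le_sum fun m _ =>
    hκ (fun x y => |doubleIncrement G (τ m) (τ (m + 1)) x y| ^ p) ?_ ?_) ?_
  · intro x; simp [doubleIncrement, hp.ne']
  · intro x y; positivity
  · refine hκ (fun x y => ∑ i : Fin κ.n,
      |doubleIncrement G x y (κ.pt i.castSucc) (κ.pt i.succ)| ^ p) ?_ ?_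
    · intro x; simp [doubleIncrement, hp.ne']
    · intro x y; positivity

/-- The division points of a partition as a sequence, constant after the last one. -/
noncomputable def IntervalPartition.seq {a b : ℝ} (κ : IntervalPartition a b) (i : ℕ) : ℝ :=
  κ.pt ⟨min i κ.n, by omega⟩

namespace IntervalPartition

variable {a b : ℝ} (κ : IntervalPartition a b)

theorem seq_monotone : Monotone κ.seq := fun _ _ h =>
  κ.strictMono.monotone (Fin.mk_le_mk.2 (min_le_min_right _ h))

theorem seq_zero : κ.seq 0 = a := by
  refine Eq.trans ?_ κ.pt_first; simp [seq]

theorem seq_of_le {i : ℕ} (h : κ.n ≤ i) : κ.seq i = b := by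
  refine Eq.trans ?_ κ.pt_last; simp [seq, h, Fin.last]

theorem seq_mem (i : ℕ) : κ.seq i ∈ Icc a b := by
  constructor
  · exact κ.seq_zero.symm.trans_le (κ.seq_monotone (Nat.zero_le _))
  · exact (κ.seq_monotone (le_max_left _ _)).trans_eq (κ.seq_of_le (le_max_right i κ.n))

theorem seq_castSucc (i : Fin κ.n) : κ.seq i = κ.pt i.castSucc := by
  unfold seq; congr 1; ext; simp [i.2.le]

theorem seq_succ (i : Fin κ.n) : κ.seq (i + 1) = κ.pt i.succ := by
  unfold seq; congr 1; ext; simp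

theorem seq_sub_le_mesh {i : ℕ} (hi : i < κ.n) : κ.seq (i + 1) - κ.seq i ≤ κ.mesh := by
  have := le_ciSup (f := fun i : Fin κ.n => κ.pt i.succ - κ.pt i.castSucc)
    (Set.finite_range _).bddAbove ⟨i, hi⟩
  rwa [← κ.seq_castSucc, ← κ.seq_succ] at this

theorem mesh_nonneg : 0 ≤ κ.mesh :=
  Real.iSup_nonneg fun _ => sub_nonneg.2 (κ.strictMono Fin.castSucc_lt_succ).le

end IntervalPartition

theorem pVar₂_mono {p : ℝ} (hp : 0 < p) (G : ℝ → ℝ → ℝ) {a b c d : ℝ} (hc : c ≤ a) (hd : b ≤ d) :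
    pVar₂ p G a b a b ≤ pVar₂ p G c d c d := by
  refine iSup₂_le fun κ η => ?_
  obtain ⟨κ', hκ'⟩ := exists_partition_sum_le κ.seq κ.seq_monotone
    (fun i => Icc_subset_Icc hc hd (κ.seq_mem i)) κ.n
  obtain ⟨η', hη'⟩ := exists_partition_sum_le η.seq η.seq_monotone
    (fun i => Icc_subset_Icc hc hd (η.seq_mem i)) η.n
  refine le_trans (ENNReal.ofReal_le_ofReal (Real.rpow_le_rpow (by positivity) ?_ (by positivity)))
    (le_iSup₂ (f := fun (κ η : IntervalPartition c d) => ENNReal.ofReal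
      ((∑ i : Fin κ.n, ∑ j : Fin η.n,
        |doubleIncrement G (κ.pt i.castSucc) (κ.pt i.succ)
          (η.pt j.castSucc) (η.pt j.succ)| ^ p) ^ (1 / p))) κ' η')
  simp only [← IntervalPartition.seq_castSucc κ, ← IntervalPartition.seq_succ κ,
    ← IntervalPartition.seq_castSucc η, ← IntervalPartition.seq_succ η]
  rw [← Finset.sum_range (n := κ.n) fun i => ∑ j : Fin η.n,
    |doubleIncrement G (κ.seq i) (κ.seq (i + 1)) (η.seq j) (η.seq (j + 1))| ^ p]
  refine le_trans (Finset.sum_le_sum fun m _ => ?_)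
    (hκ' (fun x y => ∑ i : Fin η'.n,
      |doubleIncrement G x y (η'.pt i.castSucc) (η'.pt i.succ)| ^ p) ?_ ?_)
  · rw [← Finset.sum_range (n := η.n) fun j =>
      |doubleIncrement G (κ.seq m) (κ.seq (m + 1)) (η.seq j) (η.seq (j + 1))| ^ p]
    refine hη' (fun x y => |doubleIncrement G (κ.seq m) (κ.seq (m + 1)) x y| ^ p) ?_ ?_
    · intro x; simp [doubleIncrement, hp.ne']
    · intro x y; positivity
  · intro x; simp [doubleIncrement, hp.ne']
  · intro x y; positivity

/-- The tags of a tagged partition as a sequence, extended by the right end point. -/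
noncomputable def TaggedIntervalPartition.tagSeq {a b : ℝ} (κ : TaggedIntervalPartition a b)
    (i : ℕ) : ℝ :=
  if h : i < κ.n then κ.tag ⟨i, h⟩ else b

namespace TaggedIntervalPartition

variable {a b : ℝ} (κ : TaggedIntervalPartition a b)

theorem tagSeq_mem {i : ℕ} (hi : i < κ.n) : κ.tagSeq i ∈ Icc (κ.seq i) (κ.seq (i + 1)) := by
  have := κ.tag_mem ⟨i, hi⟩
  rw [← κ.seq_castSucc, ← κ.seq_succ] at this
  simpa [tagSeq, hi] using this

theorem tagSeq_le {i j : ℕ} (hij : i ≤ j) (hj : j < κ.n) : κ.tagSeq i ≤ κ.tagSeq j := by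
  rcases hij.eq_or_lt with rfl | h
  · exact le_rfl
  · exact ((κ.tagSeq_mem (h.trans hj)).2.trans (κ.seq_monotone h)).trans (κ.tagSeq_mem hj).1

theorem tagSeq_mem_Icc {i : ℕ} (hi : i < κ.n) : κ.tagSeq i ∈ Icc a b :=
  ⟨(κ.seq_mem i).1.trans (κ.tagSeq_mem hi).1, (κ.tagSeq_mem hi).2.trans (κ.seq_mem _).2⟩

end TaggedIntervalPartition

/-- There are tagged partitions of arbitrarily small mesh. -/
theorem exists_tagged_mesh_lt {a b : ℝ} (hab : a ≤ b) {δ : ℝ} (hδ : 0 < δ) :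
    ∃ κ : TaggedIntervalPartition a b, κ.mesh < δ := by
  obtain ⟨m, hm⟩ := exists_nat_gt ((b - a) / δ)
  have hm0 : (0 : ℝ) < m := lt_of_le_of_lt (div_nonneg (sub_nonneg.2 hab) hδ.le) hm
  have hstep : (b - a) / m < δ := by
    rw [div_lt_iff₀ hδ] at hm
    rw [div_lt_iff₀ hm0]; linarith
  rcases hab.eq_or_lt with rfl | hab
  · refine ⟨⟨⟨0, fun _ => a, fun i j h => absurd h (by have := i.2; have := j.2; rw [Fin.lt_def]; omega), rfl, rfl⟩, fun i => i.elim0,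
      fun i => i.elim0⟩, ?_⟩
    rw [IntervalPartition.mesh, Real.iSup_of_isEmpty]; exact hδ
  · have hd : 0 < (b - a) / m := div_pos (sub_pos.2 hab) hm0
    have hs : StrictMono fun i : Fin (m + 1) => a + (i : ℕ) * ((b - a) / m) := by
      intro i j hij
      have : ((i : ℕ) : ℝ) < (j : ℕ) := by exact_mod_cast hij
      simp only
      nlinarith
    refine ⟨⟨⟨m, fun i => a + (i : ℕ) * ((b - a) / m), hs, by simp, ?_⟩,
      fun i => a + (i : ℕ) * ((b - a) / m), fun i => ⟨le_rfl, ?_⟩⟩, ?_⟩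
    · simp; field_simp; ring
    · exact hs.monotone Fin.castSucc_lt_succ.le
    · refine lt_of_le_of_lt (Real.iSup_le (fun i => ?_) hd.le) hstep
      simp; linarith

end Partitions

/-! ### Step functions and the blocks they cut out of a partition -/

section Steps

/-- `g` is a function on `[0, T]` that factors through a monotone map into `{0, …, N}`. -/
def IsStep (T : ℝ) (N : ℕ) (g : ℝ → ℝ) : Prop :=
  ∃ (φ : ℝ → ℕ) (F : ℕ → ℝ), MonotoneOn φ (Icc 0 T) ∧ (∀ x ∈ Icc 0 T, φ x ≤ N) ∧
    ∀ x ∈ Icc 0 T, g x = F (φ x)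

theorem isStep_of_fiber {T : ℝ} {N : ℕ} {g : ℝ → ℝ} (φ : ℝ → ℕ) (hφ : MonotoneOn φ (Icc 0 T))
    (hN : ∀ x ∈ Icc 0 T, φ x ≤ N)
    (hg : ∀ x ∈ Icc 0 T, ∀ y ∈ Icc 0 T, φ x = φ y → g x = g y) : IsStep T N g := by
  classical
  refine ⟨φ, fun n => if h : ∃ x ∈ Icc 0 T, φ x = n then g h.choose else 0, hφ, hN, ?_⟩
  intro x hx
  have h : ∃ y ∈ Icc 0 T, φ y = φ x := ⟨x, hx, rfl⟩
  simp only [dif_pos h]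
  exact hg _ hx _ h.choose_spec.1 h.choose_spec.2.symm

/-- The sum of the two level maps separates pairs of levels: both maps move in the same direction,
so equal sums force equal summands. Hence the level counts add instead of multiplying. -/
theorem IsStep.sub {T : ℝ} {N M : ℕ} {g h : ℝ → ℝ} (hg : IsStep T N g) (hh : IsStep T M h) :
    IsStep T (N + M) (fun x => g x - h x) := by
  obtain ⟨φ, F, hφ, hφN, hF⟩ := hg
  obtain ⟨ψ, G, hψ, hψM, hG⟩ := hh
  refine isStep_of_fiber (fun x => φ x + ψ x)
    (fun x hx y hy hxy => Nat.add_le_add (hφ hx hy hxy) (hψ hx hy hxy))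
    (fun x hx => Nat.add_le_add (hφN x hx) (hψM x hx)) fun x hx y hy e => ?_
  have : φ x = φ y ∧ ψ x = ψ y := by
    rcases le_total x y with hxy | hxy
    · have := hφ hx hy hxy; have := hψ hx hy hxy; omega
    · have := hφ hy hx hxy; have := hψ hy hx hxy; omega
  simp only [hF x hx, hF y hy, hG x hx, hG y hy, this.1, this.2]

theorem IsStep.bounded {T : ℝ} {N : ℕ} {g : ℝ → ℝ} (hg : IsStep T N g) :
    ∃ c, 0 ≤ c ∧ ∀ x ∈ Icc 0 T, |g x| ≤ c := by
  obtain ⟨φ, F, -, hN, hF⟩ := hg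
  refine ⟨∑ n ∈ Finset.range (N + 1), |F n|, by positivity, fun x hx => ?_⟩
  rw [hF x hx]
  exact Finset.single_le_sum (f := fun n => |F n|) (fun _ _ => abs_nonneg _)
    (Finset.mem_range.2 (Nat.lt_succ_of_le (hN x hx)))

/-- A function that oscillates by at most `ε` on the fibres of a monotone map into
`{0, …, N}` is within `ε` of a step function. -/
theorem exists_isStep_of_fiber {T : ℝ} {N : ℕ} {f : ℝ → ℝ} {ε : ℝ} (φ : ℝ → ℕ)
    (hφ : MonotoneOn φ (Icc 0 T)) (hN : ∀ x ∈ Icc 0 T, φ x ≤ N)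
    (hf : ∀ x ∈ Icc 0 T, ∀ y ∈ Icc 0 T, φ x = φ y → |f x - f y| ≤ ε) :
    ∃ g, IsStep T N g ∧ ∀ x ∈ Icc 0 T, |f x - g x| ≤ ε := by
  classical
  let F : ℕ → ℝ := fun n => if h : ∃ x ∈ Icc 0 T, φ x = n then f h.choose else 0
  refine ⟨fun x => F (φ x), ⟨φ, F, hφ, hN, fun _ _ => rfl⟩, fun x hx => ?_⟩
  have h : ∃ y ∈ Icc 0 T, φ y = φ x := ⟨x, hx, rfl⟩
  simp only [F, dif_pos h]
  exact hf _ hx _ h.choose_spec.1 h.choose_spec.2.symm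

/-- A monotone map on `{0, …, n-1}` has initial segments as its sublevel sets. -/
theorem exists_sublevel (ψ : ℕ → ℕ) (n : ℕ) (hψ : ∀ i j, i ≤ j → j < n → ψ i ≤ ψ j) :
    ∃ J : ℕ → ℕ, Monotone J ∧ (∀ m, J m ≤ n) ∧ ∀ m i, i < n → (ψ i < m ↔ i < J m) := by
  have key : ∀ m, ∃ j ≤ n, ∀ i < n, (ψ i < m ↔ i < j) := by
    intro m
    -- The least such `j` is the first index at level `m` or above, capped at `n`.
    have hex : ∃ j, ¬ ψ j < m ∨ n ≤ j := ⟨n, Or.inr le_rfl⟩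
    refine ⟨Nat.find hex, Nat.find_min' hex (Or.inr le_rfl), fun i hi => ⟨fun h => ?_, fun h => ?_⟩⟩
    · by_contra hc
      rcases Nat.find_spec hex with h1 | h1
      · exact h1 (lt_of_le_of_lt (hψ _ _ (not_lt.1 hc) hi) h)
      · omega
    · have := Nat.find_min hex h
      push Not at this
      exact this.1
  choose J hJn hJ using key
  refine ⟨J, monotone_nat_of_le_succ fun m => ?_, hJn, fun m i hi => hJ m i hi⟩
  by_contra hc
  have h1 := hJn m
  have h2 := (hJ m (J (m + 1)) (by omega)).2 (by omega)
  have h3 := (hJ (m + 1) (J (m + 1)) (by omega)).1 (by omega)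
  omega

theorem sum_Ico_telescope {H : Type*} [AddCommGroup H] (y : ℕ → H) {a b : ℕ} (hab : a ≤ b) :
    ∑ i ∈ Finset.Ico a b, (y (i + 1) - y i) = y b - y a := by
  induction b, hab using Nat.le_induction with
  | base => simp
  | succ b hb ih => rw [Finset.sum_Ico_succ_top hb, ih]; abel

/-- Grouping the terms of a sum of increments by the value of a monotone map. -/
theorem sum_eq_sum_sublevel {H : Type*} [AddCommGroup H] [Module ℝ H] (y : ℕ → H) (ψ : ℕ → ℕ)
    (F : ℕ → ℝ) (n N : ℕ) (hN : ∀ i < n, ψ i ≤ N) (J : ℕ → ℕ) (hJm : Monotone J)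
    (hJn : ∀ m, J m ≤ n) (hJ : ∀ m i, i < n → (ψ i < m ↔ i < J m)) :
    ∑ i ∈ Finset.range n, F (ψ i) • (y (i + 1) - y i) =
      ∑ m ∈ Finset.range (N + 1), F m • (y (J (m + 1)) - y (J m)) := by
  rw [← Finset.sum_fiberwise_of_maps_to (s := Finset.range n) (t := Finset.range (N + 1)) (g := ψ)
    (fun i hi => Finset.mem_range.2 (Nat.lt_succ_of_le (hN i (Finset.mem_range.1 hi))))]
  refine Finset.sum_congr rfl fun m _ => ?_
  have e : (Finset.range n).filter (fun i => ψ i = m) = Finset.Ico (J m) (J (m + 1)) := by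
    ext i
    simp only [Finset.mem_filter, Finset.mem_range, Finset.mem_Ico]
    have := hJn (m + 1)
    constructor
    · rintro ⟨hi, he⟩
      have := hJ m i hi; have := hJ (m + 1) i hi; omega
    · rintro ⟨h1, h2⟩
      have hi : i < n := by omega
      have := hJ m i hi; have := hJ (m + 1) i hi; omega
  rw [← sum_Ico_telescope y (hJm (Nat.le_succ m)), Finset.smul_sum, ← e]
  refine Finset.sum_congr rfl fun i hi => ?_
  rw [(Finset.mem_filter.1 hi).2]

end Steps

/-! ### Riemann–Stieltjes sums in a Hilbert space -/

section Hilbert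

variable {H : Type*} [NormedAddCommGroup H] [InnerProductSpace ℝ H]

/-- The Riemann–Stieltjes sum with a vector-valued integrator. -/
noncomputable def vecSum (f : ℝ → ℝ) (Y : ℝ → H) {a b : ℝ} (κ : TaggedIntervalPartition a b) : H :=
  ∑ i ∈ Finset.range κ.n, f (κ.tagSeq i) • (Y (κ.seq (i + 1)) - Y (κ.seq i))

theorem vecSum_sub (f g : ℝ → ℝ) (Y : ℝ → H) {a b : ℝ} (κ : TaggedIntervalPartition a b) :
    vecSum (fun x => f x - g x) Y κ = vecSum f Y κ - vecSum g Y κ := by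
  simp only [vecSum, sub_smul, Finset.sum_sub_distrib]

/-- The `p`-variation of the covariance on `[a, b]²`, as a real number. -/
noncomputable def covVar (p : ℝ) (Y : ℝ → H) (a b : ℝ) : ℝ :=
  (pVar₂ p (fun s t => inner ℝ (Y s) (Y t)) a b a b).toReal

theorem doubleIncrement_inner (Y : ℝ → H) (s s' t t' : ℝ) :
    doubleIncrement (fun s t => inner ℝ (Y s) (Y t)) s s' t t' =
      inner ℝ (Y s' - Y s) (Y t' - Y t) := by
  simp only [doubleIncrement, inner_sub_left, inner_sub_right]; ring

/-- The step function estimate: a monotone sequence of `M + 1` points and coefficients bounded by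
`c`. -/
theorem norm_sq_sum_le {p : ℝ} (hp : 1 ≤ p) (Y : ℝ → H) {a b : ℝ} (τ : ℕ → ℝ) (hτ : Monotone τ)
    (hab : ∀ i, τ i ∈ Icc a b) (M : ℕ) (F : ℕ → ℝ) (c : ℝ)
    (hF : ∀ m < M, τ (m + 1) ≠ τ m → |F m| ≤ c)
    (hV : pVar₂ p (fun s t => inner ℝ (Y s) (Y t)) a b a b < ∞) :
    ‖∑ m ∈ Finset.range M, F m • (Y (τ (m + 1)) - Y (τ m))‖ ^ 2 ≤
      c ^ 2 * (((M : ℝ) ^ (1 - 1 / p)) ^ 2 * covVar p Y a b) := by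
  have hp0 : 0 < p := by linarith
  set D : ℕ → H := fun m => Y (τ (m + 1)) - Y (τ m) with hD
  have hterm : ∀ m < M, ∀ k < M, inner ℝ (F m • D m) (F k • D k) ≤
      c ^ 2 * |inner ℝ (D m) (D k)| := by
    intro m hm k hk
    rw [real_inner_smul_left, real_inner_smul_right]
    -- On an empty block the increment vanishes, so the coefficient, which may be arbitrary there,
    -- needs no bound.
    by_cases h1 : τ (m + 1) = τ m
    · simp [hD, h1]
    by_cases h2 : τ (k + 1) = τ k
    · simp [hD, h2]
    have e1 := hF m hm h1
    have e2 := hF k hk h2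
    refine (le_abs_self _).trans ?_
    rw [abs_mul, abs_mul, ← mul_assoc, sq]
    gcongr
    exact (abs_nonneg _).trans e1
  have hsum : ‖∑ m ∈ Finset.range M, F m • D m‖ ^ 2 ≤
      c ^ 2 * ∑ x ∈ Finset.range M ×ˢ Finset.range M, |inner ℝ (D x.1) (D x.2)| := by
    rw [← real_inner_self_eq_norm_sq, sum_inner, Finset.mul_sum, Finset.sum_product]
    refine Finset.sum_le_sum fun m hm => ?_
    rw [inner_sum]
    exact Finset.sum_le_sum fun k hk =>
      hterm m (Finset.mem_range.1 hm) k (Finset.mem_range.1 hk)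
  have hvar := rpow_sum_le_pVar₂ hp0 (G := fun s t => inner ℝ (Y s) (Y t)) τ hτ hab M
  rw [ENNReal.ofReal_le_iff_le_toReal hV.ne] at hvar
  simp only [doubleIncrement_inner] at hvar
  refine hsum.trans (mul_le_mul_of_nonneg_left ?_ (sq_nonneg c))
  -- Hölder over the M² pairs; after taking p-th roots the factor (M²)^(p−1) becomes M^{2(1−1/p)}.
  have hh := Real.rpow_sum_le_const_mul_sum_rpow (Finset.range M ×ˢ Finset.range M)
    (fun x => inner ℝ (D x.1) (D x.2)) hp
  rw [Finset.sum_product (f := fun x : ℕ × ℕ => |inner ℝ (D x.1) (D x.2)| ^ p)] at hh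
  have h2 := Real.rpow_le_rpow (by positivity) hh (one_div_nonneg.2 hp0.le)
  rw [← Real.rpow_mul (by positivity), mul_one_div_cancel hp0.ne', Real.rpow_one,
    Real.mul_rpow (by positivity) (by positivity), ← Real.rpow_mul (by positivity)] at h2
  refine h2.trans ?_
  have e : ((Finset.range M ×ˢ Finset.range M).card : ℝ) ^ ((p - 1) * (1 / p)) =
      ((M : ℝ) ^ (1 - 1 / p)) ^ 2 := by
    have : (p - 1) * (1 / p) = 1 - 1 / p := by field_simp
    rw [this, Finset.card_product, Finset.card_range, Nat.cast_mul,
      Real.mul_rpow (by positivity) (by positivity), sq]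
  rw [e]
  exact mul_le_mul_of_nonneg_left hvar (by positivity)

/-- Riemann–Stieltjes sums of a step function, with the block structure exposed. -/
theorem exists_blocks {T : ℝ} {N : ℕ} {φ : ℝ → ℕ} (hφ : MonotoneOn φ (Icc 0 T))
    (hφN : ∀ x ∈ Icc 0 T, φ x ≤ N) {a b : ℝ} (ha : 0 ≤ a) (hb : b ≤ T)
    (κ : TaggedIntervalPartition a b) :
    ∃ J : ℕ → ℕ, Monotone J ∧ (∀ m, J m ≤ κ.n) ∧
      (∀ m i, i < κ.n → (φ (κ.tagSeq i) < m ↔ i < J m)) ∧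
      ∀ (g : ℝ → ℝ) (F : ℕ → ℝ), (∀ x ∈ Icc 0 T, g x = F (φ x)) → ∀ Y : ℝ → H,
        vecSum g Y κ = ∑ m ∈ Finset.range (N + 1),
          F m • (Y (κ.seq (J (m + 1))) - Y (κ.seq (J m))) := by
  have hmem : ∀ i < κ.n, κ.tagSeq i ∈ Icc 0 T := fun i hi =>
    Icc_subset_Icc ha hb (κ.tagSeq_mem_Icc hi)
  obtain ⟨J, hJm, hJn, hJ⟩ := exists_sublevel (fun i => φ (κ.tagSeq i)) κ.n
    fun i j hij hj => hφ (hmem i (by omega)) (hmem j hj) (κ.tagSeq_le hij hj)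
  refine ⟨J, hJm, hJn, hJ, fun g F hg Y => ?_⟩
  rw [← sum_eq_sum_sublevel (fun i => Y (κ.seq i)) (fun i => φ (κ.tagSeq i)) F κ.n N
    (fun i hi => hφN _ (hmem i hi)) J hJm hJn hJ]
  exact Finset.sum_congr rfl fun i hi => by rw [hg _ (hmem i (Finset.mem_range.1 hi))]

/-- The sum collapses to `N + 1` block increments, so the bound does not see how many points `κ`
has. -/
theorem IsStep.norm_vecSum_le {T : ℝ} {N : ℕ} {g : ℝ → ℝ} (hg : IsStep T N g) {c : ℝ}
    (hc0 : 0 ≤ c) (hc : ∀ x ∈ Icc 0 T, |g x| ≤ c) {p : ℝ} (hp : 1 ≤ p) (Y : ℝ → H) {a b : ℝ}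
    (ha : 0 ≤ a) (hb : b ≤ T) (hV : pVar₂ p (fun s t => inner ℝ (Y s) (Y t)) a b a b < ∞)
    (κ : TaggedIntervalPartition a b) :
    ‖vecSum g Y κ‖ ≤ √(covVar p Y a b) * (c * ((N + 1 : ℕ) : ℝ) ^ (1 - 1 / p)) := by
  obtain ⟨φ, F, hφ, hφN, hF⟩ := hg
  obtain ⟨J, hJm, hJn, hJ, hsum⟩ := exists_blocks (H := H) hφ hφN ha hb κ
  have hcov : 0 ≤ covVar p Y a b := ENNReal.toReal_nonneg
  have h := norm_sq_sum_le hp Y (fun m => κ.seq (J m)) (fun i j hij => κ.seq_monotone (hJm hij))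
    (fun i => κ.seq_mem _) (N + 1) F c ?_ hV
  · rw [← hsum g F hF Y] at h
    refine abs_le_of_sq_le_sq' ?_ (by positivity) |>.2
    refine h.trans_eq ?_
    rw [mul_pow, mul_pow, Real.sq_sqrt hcov]; ring
  -- A nonempty block contains the index `J m`, whose tag lies at level `m`; so `F m` is a value of
  -- `g`.
  · intro m _ hne
    have hlt : J m < J (m + 1) := lt_of_le_of_ne (hJm (Nat.le_succ m)) fun e => hne (by rw [e])
    have hn : J m < κ.n := hlt.trans_le (hJn _)
    have h1 := hJ m (J m) hn
    have h2 := hJ (m + 1) (J m) hn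
    have hm : φ (κ.tagSeq (J m)) = m := by omega
    have hx := Icc_subset_Icc ha hb (κ.tagSeq_mem_Icc hn)
    rw [← hm, ← hF _ hx]
    exact hc _ hx

/-- The filter of small mesh on tagged partitions. -/
noncomputable def meshFilter (a b : ℝ) : Filter (TaggedIntervalPartition a b) :=
  comap (fun κ => κ.mesh) (𝓝 0)

theorem hasBasis_meshFilter (a b : ℝ) : (meshFilter a b).HasBasis (fun δ : ℝ => 0 < δ)
    fun δ => {κ | κ.mesh < δ} := by
  refine (Metric.nhds_basis_ball.comap _).congr (fun _ => Iff.rfl) fun δ _ => ?_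
  ext κ
  simp [abs_of_nonneg κ.mesh_nonneg]

theorem meshFilter_neBot {a b : ℝ} (hab : a ≤ b) : (meshFilter a b).NeBot :=
  (hasBasis_meshFilter a b).neBot_iff.2 fun hδ => exists_tagged_mesh_lt hab hδ

/-- Step functions are Riemann–Stieltjes integrable with respect to continuous functions. -/
theorem IsStep.exists_tendsto {T : ℝ} {N : ℕ} {g : ℝ → ℝ} (hg : IsStep T N g) {Y : ℝ → H}
    (hY : ContinuousOn Y (Icc 0 T)) {a b : ℝ} (ha : 0 ≤ a) (hab : a ≤ b) (hb : b ≤ T) :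
    ∃ I, Tendsto (vecSum g Y) (meshFilter a b) (𝓝 I) := by
  obtain ⟨φ, F, hφ, hφN, hF⟩ := hg
  choose J hJm hJn hJ hsum using fun κ : TaggedIntervalPartition a b =>
    exists_blocks (H := H) hφ hφN ha hb κ
  -- `sInf (U m)` is where `φ` reaches level `m`, or `b` if it does not; the block ends converge to
  -- it.
  let U : ℕ → Set ℝ := fun m => insert b {x | x ∈ Icc a b ∧ m ≤ φ x}
  have hUsub : ∀ m, U m ⊆ Icc a b := by
    intro m x hx
    rcases hx with rfl | hx
    · exact ⟨hab, le_rfl⟩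
    · exact hx.1
  have hbdd : ∀ m, BddBelow (U m) := fun m => ⟨a, fun x hx => (hUsub m hx).1⟩
  have hne : ∀ m, (U m).Nonempty := fun m => ⟨b, mem_insert _ _⟩
  have hcmem : ∀ m, sInf (U m) ∈ Icc a b := fun m =>
    ⟨le_csInf (hne m) fun x hx => (hUsub m hx).1, csInf_le (hbdd m) (mem_insert _ _)⟩
  -- The tags just before and just after the division point `κ.seq (J κ m)` lie on either side of
  -- `sInf (U m)`, each within one mesh length of that division point. At `J κ m = 0` or `κ.n` an
  -- end point replaces the missing tag.
  have hclose : ∀ (κ : TaggedIntervalPartition a b) m,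
      dist (κ.seq (J κ m)) (sInf (U m)) ≤ κ.mesh := by
    intro κ m
    rw [Real.dist_eq, abs_le]
    have hmesh := κ.mesh_nonneg
    constructor
    · rcases (hJn κ m).eq_or_lt with e | e
      · rw [e, κ.seq_of_le le_rfl]
        linarith [(hcmem m).2]
      · have h1 : κ.tagSeq (J κ m) ∈ U m := by
          refine mem_insert_of_mem _ ⟨κ.tagSeq_mem_Icc e, ?_⟩
          have := hJ κ m _ e
          omega
        have h2 := csInf_le (hbdd m) h1
        have h3 := (κ.tagSeq_mem e).2
        have h4 := κ.seq_sub_le_mesh e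
        linarith
    · rcases Nat.eq_zero_or_pos (J κ m) with e | e
      · rw [e, κ.seq_zero]
        linarith [(hcmem m).1]
      · obtain ⟨j, hj⟩ : ∃ j, J κ m = j + 1 := ⟨J κ m - 1, by omega⟩
        have hjn : j < κ.n := by have := hJn κ m; omega
        have hlt : φ (κ.tagSeq j) < m := (hJ κ m j hjn).2 (by omega)
        have h2 : κ.tagSeq j ≤ sInf (U m) := by
          refine le_csInf (hne m) fun x hx => ?_
          rcases hx with rfl | ⟨hx, hmx⟩
          · exact (κ.tagSeq_mem_Icc hjn).2
          · by_contra hc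
            have := hφ (Icc_subset_Icc ha hb hx)
              (Icc_subset_Icc ha hb (κ.tagSeq_mem_Icc hjn)) (not_le.1 hc).le
            omega
        have h3 := (κ.tagSeq_mem hjn).1
        have h4 := κ.seq_sub_le_mesh hjn
        rw [hj]
        linarith
  have hlim : ∀ m, Tendsto (fun κ : TaggedIntervalPartition a b => Y (κ.seq (J κ m)))
      (meshFilter a b) (𝓝 (Y (sInf (U m)))) := by
    intro m
    refine (hY _ (Icc_subset_Icc ha hb (hcmem m))).tendsto.comp
      (tendsto_nhdsWithin_iff.2 ⟨?_, Eventually.of_forall fun κ =>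
        Icc_subset_Icc ha hb (κ.seq_mem _)⟩)
    rw [tendsto_iff_dist_tendsto_zero]
    exact squeeze_zero (fun _ => dist_nonneg) (fun κ => hclose κ m) tendsto_comap
  refine ⟨∑ m ∈ Finset.range (N + 1), F m • (Y (sInf (U (m + 1))) - Y (sInf (U m))), ?_⟩
  refine Tendsto.congr (fun κ => (hsum κ g F hF Y).symm) ?_
  exact tendsto_finsetSum _ fun m _ => ((hlim (m + 1)).sub (hlim m)).const_smul (F m)

/-- The data of a fast approximation of `f` by step functions on `[0, T]`. -/
structure StepApprox (p T : ℝ) (f : ℝ → ℝ) where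
  g : ℕ → ℝ → ℝ
  N : ℕ → ℕ
  e : ℕ → ℝ
  isStep : ∀ k, IsStep T (N k) (g k)
  close : ∀ k, ∀ x ∈ Icc 0 T, |f x - g k x| ≤ e k
  lim : Tendsto e atTop (𝓝 0)
  e_nonneg : ∀ k, 0 ≤ e k
  summable : Summable fun k =>
    (e k + e (k + 1)) * ((N (k + 1) + N k + 1 : ℕ) : ℝ) ^ (1 - 1 / p)

namespace StepApprox

variable {p T : ℝ} {f : ℝ → ℝ}

/-- The size of the `k`-th term of the telescoping decomposition. -/
noncomputable def size (A : StepApprox p T f) (k : ℕ) : ℝ :=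
  (A.e k + A.e (k + 1)) * ((A.N (k + 1) + A.N k + 1 : ℕ) : ℝ) ^ (1 - 1 / p)

/-- For fixed `κ` there are finitely many tags, so the sums of `A.g k` tend to that of `f`.
Successive differences are step functions of size at most e_k + e_{k+1}, and the step estimate makes
the tail bound uniform in `κ`. -/
theorem dist_vecSum_le (A : StepApprox p T f) (hp : 1 ≤ p) (Y : ℝ → H) {a b : ℝ} (ha : 0 ≤ a) (hb : b ≤ T)
    (hV : pVar₂ p (fun s t => inner ℝ (Y s) (Y t)) a b a b < ∞)
    (κ : TaggedIntervalPartition a b) (k : ℕ) :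
    dist (vecSum (A.g k) Y κ) (vecSum f Y κ) ≤
      √(covVar p Y a b) * ∑' m, A.size (m + k) := by
  have hlim : Tendsto (fun k => vecSum (A.g k) Y κ) atTop (𝓝 (vecSum f Y κ)) := by
    refine tendsto_finsetSum _ fun i hi => Tendsto.smul_const ?_ _
    rw [tendsto_iff_dist_tendsto_zero]
    refine squeeze_zero (fun _ => dist_nonneg) (fun k => ?_) A.lim
    rw [dist_comm]
    exact A.close k _ (Icc_subset_Icc ha hb (κ.tagSeq_mem_Icc (Finset.mem_range.1 hi)))
  have hstep : ∀ k, dist (vecSum (A.g k) Y κ) (vecSum (A.g (k + 1)) Y κ) ≤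
      √(covVar p Y a b) * A.size k := by
    intro k
    rw [dist_comm, dist_eq_norm, ← vecSum_sub]
    refine ((A.isStep (k + 1)).sub (A.isStep k)).norm_vecSum_le
      (add_nonneg (A.e_nonneg k) (A.e_nonneg (k + 1))) (fun x hx => ?_) hp Y ha hb hV κ
    have h1 := A.close k x hx
    have h2 := A.close (k + 1) x hx
    calc |A.g (k + 1) x - A.g k x| = |(f x - A.g k x) - (f x - A.g (k + 1) x)| := by ring_nf
      _ ≤ |f x - A.g k x| + |f x - A.g (k + 1) x| := abs_sub _ _
      _ ≤ _ := add_le_add h1 h2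
  have := dist_le_tsum_of_dist_le_of_tendsto _ hstep (A.summable.mul_left _) hlim k
  rw [tsum_mul_left] at this
  simpa only [add_comm k] using this

theorem tendsto_tail (A : StepApprox p T f) : Tendsto (fun k => ∑' m, A.size (m + k)) atTop (𝓝 0) :=
  tendsto_sum_nat_add A.size

/-- Sums of `f` are bounded by a constant depending on the approximation only. -/
theorem exists_bound (A : StepApprox p T f) (hp : 1 ≤ p) : ∃ K : ℝ, ∀ {H : Type*} [NormedAddCommGroup H]
    [InnerProductSpace ℝ H] (Y : ℝ → H) {a b : ℝ}, 0 ≤ a → b ≤ T →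
    pVar₂ p (fun s t => inner ℝ (Y s) (Y t)) a b a b < ∞ →
    ∀ κ : TaggedIntervalPartition a b, ‖vecSum f Y κ‖ ≤ √(covVar p Y a b) * K := by
  obtain ⟨c, hc0, hc⟩ := (A.isStep 0).bounded
  -- The first term bounds the sums of `A.g 0`, the series their distance to those of `f`.
  refine ⟨c * ((A.N 0 + 1 : ℕ) : ℝ) ^ (1 - 1 / p) + ∑' m, A.size (m + 0), ?_⟩
  intro H _ _ Y a b ha hb hV κ
  have h1 := A.dist_vecSum_le hp Y ha hb hV κ 0
  have h2 := (A.isStep 0).norm_vecSum_le hc0 hc hp Y ha hb hV κ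
  rw [dist_comm, dist_eq_norm] at h1
  rw [mul_add]
  have := norm_le_norm_add_norm_sub' (vecSum f Y κ) (vecSum (A.g 0) Y κ)
  linarith

/-- Sums of `f` are uniformly close to those of a step function, which converge; so they are Cauchy
as the mesh shrinks. -/
theorem exists_tendsto [CompleteSpace H] (A : StepApprox p T f) (hp : 1 ≤ p) {Y : ℝ → H} (hY : ContinuousOn Y (Icc 0 T))
    {a b : ℝ} (ha : 0 ≤ a) (hab : a ≤ b) (hb : b ≤ T)
    (hV : pVar₂ p (fun s t => inner ℝ (Y s) (Y t)) a b a b < ∞) :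
    ∃ I, Tendsto (vecSum f Y) (meshFilter a b) (𝓝 I) := by
  have := meshFilter_neBot hab
  rw [← cauchy_map_iff_exists_tendsto, Metric.cauchy_iff]
  refine ⟨inferInstance, fun ε hε => ?_⟩
  have hr : Tendsto (fun k => √(covVar p Y a b) * ∑' m, A.size (m + k)) atTop (𝓝 0) := by
    simpa using A.tendsto_tail.const_mul (√(covVar p Y a b))
  -- Four errors: two replacements of `f` by `A.g k`, and two distances to the limit `I`.
  obtain ⟨k, hk⟩ := (hr.eventually_lt_const (show 0 < ε / 4 by linarith)).exists
  obtain ⟨I, hI⟩ := (A.isStep k).exists_tendsto hY ha hab hb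
  refine ⟨_, image_mem_map (Metric.tendsto_nhds.1 hI (ε / 4) (by linarith)), ?_⟩
  rintro _ ⟨κ, hκ, rfl⟩ _ ⟨η, hη, rfl⟩
  have h1 := A.dist_vecSum_le hp Y ha hb hV κ k
  have h2 := A.dist_vecSum_le hp Y ha hb hV η k
  simp only [mem_ofPred_eq] at hκ hη
  have h3 := dist_triangle4 (vecSum f Y κ) (vecSum (A.g k) Y κ) (vecSum (A.g k) Y η) (vecSum f Y η)
  have h4 := dist_triangle_right (vecSum (A.g k) Y κ) (vecSum (A.g k) Y η) I
  rw [dist_comm (vecSum f Y κ) (vecSum (A.g k) Y κ)] at h3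
  linarith

end StepApprox

end Hilbert

/-! ### Step approximation of regulated functions and of functions of bounded q-variation -/

section Approximation

/-- Regulated functions are uniformly approximated by step functions. -/
theorem IsRegulatedOn.exists_isStep {f : ℝ → ℝ} {T : ℝ} (hf : IsRegulatedOn f 0 T) {ε : ℝ}
    (hε : 0 < ε) : ∃ N g, IsStep T N g ∧ ∀ x ∈ Icc 0 T, |f x - g x| ≤ ε := by
  classical
  have key : ∀ c ∈ Icc 0 T, ∃ δ > 0,
      (∀ x ∈ Ioo (c - δ) c, ∀ y ∈ Ioo (c - δ) c, x ∈ Icc 0 T → y ∈ Icc 0 T → |f x - f y| ≤ ε) ∧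
      (∀ x ∈ Ioo c (c + δ), ∀ y ∈ Ioo c (c + δ), x ∈ Icc 0 T → y ∈ Icc 0 T → |f x - f y| ≤ ε) := by
    intro c hc
    have hosc : ∀ {l : Filter ℝ} {r : ℝ}, Tendsto f l (𝓝 r) →
        ∀ᶠ x in l, |f x - r| < ε / 2 := fun h => by
      simpa [Real.dist_eq] using Metric.tendsto_nhds.1 h (ε / 2) (by linarith)
    have htri : ∀ {x y r : ℝ}, |f x - r| < ε / 2 → |f y - r| < ε / 2 → |f x - f y| ≤ ε := by
      intro x y r h1 h2
      have := abs_sub_le (f x) r (f y)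
      rw [abs_sub_comm r] at this
      linarith
    have hl : ∃ δ > 0, ∀ x ∈ Ioo (c - δ) c, ∀ y ∈ Ioo (c - δ) c,
        x ∈ Icc 0 T → y ∈ Icc 0 T → |f x - f y| ≤ ε := by
      rcases hc.1.eq_or_lt with e | e
      · refine ⟨1, one_pos, fun x hx y hy hx' => ?_⟩
        have := hx.2; have := hx'.1; linarith
      · obtain ⟨r, hr⟩ := hf.1 c ⟨e, hc.2⟩
        obtain ⟨l, hlc, hl⟩ := mem_nhdsLT_iff_exists_Ioo_subset.1 (hosc hr)
        rw [mem_Iio] at hlc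
        refine ⟨c - l, by linarith, fun x hx y hy _ _ => ?_⟩
        rw [sub_sub_cancel] at hx hy
        exact htri (hl hx) (hl hy)
    have hr : ∃ δ > 0, ∀ x ∈ Ioo c (c + δ), ∀ y ∈ Ioo c (c + δ),
        x ∈ Icc 0 T → y ∈ Icc 0 T → |f x - f y| ≤ ε := by
      rcases hc.2.eq_or_lt with e | e
      · refine ⟨1, one_pos, fun x hx y hy hx' => ?_⟩
        have := hx.1; have := hx'.2; linarith
      · obtain ⟨r, hr⟩ := hf.2 c ⟨hc.1, e⟩
        obtain ⟨l, hlc, hl⟩ := mem_nhdsGT_iff_exists_Ioo_subset.1 (hosc hr)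
        rw [mem_Ioi] at hlc
        refine ⟨l - c, by linarith, fun x hx y hy _ _ => ?_⟩
        rw [add_sub_cancel] at hx hy
        exact htri (hl hx) (hl hy)
    obtain ⟨δ₁, h1, hl⟩ := hl
    obtain ⟨δ₂, h2, hr⟩ := hr
    refine ⟨min δ₁ δ₂, lt_min h1 h2, fun x hx y hy => ?_, fun x hx y hy => ?_⟩
    · have := min_le_left δ₁ δ₂
      exact hl x ⟨by linarith [hx.1], hx.2⟩ y ⟨by linarith [hy.1], hy.2⟩
    · have := min_le_right δ₁ δ₂
      exact hr x ⟨hx.1, by linarith [hx.2]⟩ y ⟨hy.1, by linarith [hy.2]⟩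
  choose! δ hδ0 hδl hδr using key
  obtain ⟨S, hSsub, hS⟩ := (isCompact_Icc (a := (0 : ℝ)) (b := T)).elim_nhds_subcover
    (fun c => Ioo (c - δ c) (c + δ c)) fun c hc =>
      Ioo_mem_nhds (by linarith [hδ0 c hc]) (by linarith [hδ0 c hc])
  let D : Finset ℝ := S ∪ S.image (fun c => c - δ c) ∪ S.image (fun c => c + δ c)
  -- Counting both `<` and `≤` makes each breakpoint a fibre of its own, separate from the gaps
  -- beside it.
  let φ : ℝ → ℕ := fun x => (D.filter (· < x)).card + (D.filter (· ≤ x)).card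
  have hlt : ∀ {x y : ℝ}, x ≤ y → (D.filter (· < x)) ⊆ D.filter (· < y) := fun hxy d hd => by
    simp only [Finset.mem_filter] at hd ⊢
    exact ⟨hd.1, hd.2.trans_le hxy⟩
  have hle : ∀ {x y : ℝ}, x ≤ y → (D.filter (· ≤ x)) ⊆ D.filter (· ≤ y) := fun hxy d hd => by
    simp only [Finset.mem_filter] at hd ⊢
    exact ⟨hd.1, hd.2.trans hxy⟩
  -- No breakpoint lies in [x, y], so a covering interval that contains `x` also contains `y`, on
  -- the same side of its centre.
  have main : ∀ x ∈ Icc 0 T, ∀ y ∈ Icc 0 T, x < y → φ x = φ y → |f x - f y| ≤ ε := by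
    intro x hx y hy hxy hφ
    have c1 := Finset.card_le_card (hlt hxy.le)
    have c2 := Finset.card_le_card (hle hxy.le)
    simp only [φ] at hφ
    have e1 := Finset.eq_of_subset_of_card_le (hlt hxy.le) (by omega)
    have e2 := Finset.eq_of_subset_of_card_le (hle hxy.le) (by omega)
    have hD : ∀ d ∈ D, d < x ∨ y < d := by
      intro d hd
      by_contra! hc
      rcases hc.2.eq_or_lt with h | h
      · have : d ∈ D.filter (· ≤ x) := by rw [e2]; exact Finset.mem_filter.2 ⟨hd, h.le⟩
        have := (Finset.mem_filter.1 this).2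
        linarith
      · have : d ∈ D.filter (· < x) := by rw [e1]; exact Finset.mem_filter.2 ⟨hd, h⟩
        have := (Finset.mem_filter.1 this).2
        linarith [hc.1]
    obtain ⟨c, hc, hxc⟩ := mem_iUnion₂.1 (hS hx)
    have hcT := hSsub c hc
    have d1 := hD c (by simp only [D, Finset.mem_union]; exact Or.inl (Or.inl hc))
    have d2 := hD (c + δ c) (by
      simp only [D, Finset.mem_union]
      exact Or.inr (Finset.mem_image_of_mem (fun c => c + δ c) hc))
    have hx1 := hxc.1
    have hx2 := hxc.2
    have hy2 : y < c + δ c := by rcases d2 with h | h <;> linarith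
    rcases d1 with h | h
    · exact hδr c hcT x ⟨h, hx2⟩ y ⟨by linarith, hy2⟩ hx hy
    · exact hδl c hcT x ⟨hx1, by linarith⟩ y ⟨by linarith, h⟩ hx hy
  obtain ⟨g, hg, hfg⟩ := exists_isStep_of_fiber (T := T) (N := D.card + D.card) (f := f) (ε := ε) φ
    (fun x _ y _ hxy => Nat.add_le_add (Finset.card_le_card (hlt hxy))
      (Finset.card_le_card (hle hxy)))
    (fun x _ => Nat.add_le_add (Finset.card_filter_le _ _) (Finset.card_filter_le _ _))
    (fun x hx y hy e => by
      rcases lt_trichotomy x y with h | h | h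
      · exact main x hx y hy h e
      · rw [h, sub_self, abs_zero]; exact hε.le
      · rw [abs_sub_comm]; exact main y hy x hx h e.symm)
  exact ⟨_, g, hg, hfg⟩

/-- A function of finite `q`-variation is controlled by a bounded monotone function. -/
theorem exists_control {f : ℝ → ℝ} {q T : ℝ} (hq : 0 < q) (hf : pVar q f 0 T < ∞) :
    ∃ (w : ℝ → ℝ) (W : ℝ), 0 ≤ W ∧ (∀ x ∈ Icc 0 T, 0 ≤ w x ∧ w x ≤ W) ∧
      ∀ x ∈ Icc 0 T, ∀ y ∈ Icc 0 T, x ≤ y → w x + |f y - f x| ^ q ≤ w y := by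
  -- The control is w(x) = sup S(x), the q-th power of the q-variation on [0, x].
  let S : ℝ → Set ℝ := fun x => {r | ∃ (τ : ℕ → ℝ) (M : ℕ), Monotone τ ∧ (∀ i, τ i ∈ Icc 0 x) ∧
    r = ∑ m ∈ Finset.range M, |f (τ (m + 1)) - f (τ m)| ^ q}
  have hS : ∀ x ∈ Icc 0 T, ∀ r ∈ S x, r ≤ (pVar q f 0 T).toReal ^ q := by
    rintro x hx r ⟨τ, M, hτ, hmem, rfl⟩
    exact sum_rpow_le_pVar hq τ hτ (fun i => Icc_subset_Icc_right hx.2 (hmem i)) M hf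
  have hbdd : ∀ x ∈ Icc 0 T, BddAbove (S x) := fun x hx => ⟨_, hS x hx⟩
  have hne : ∀ x ∈ Icc 0 T, (S x).Nonempty := fun x hx =>
    ⟨0, fun _ => x, 0, monotone_const, fun _ => ⟨hx.1, le_rfl⟩, by simp⟩
  refine ⟨fun x => sSup (S x), (pVar q f 0 T).toReal ^ q, by positivity, fun x hx => ⟨?_, ?_⟩, ?_⟩
  · refine le_csSup (hbdd x hx)
      ⟨fun _ => x, 0, monotone_const, fun _ => ⟨hx.1, le_rfl⟩, by simp⟩
  · exact csSup_le (hne x hx) (hS x hx)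
  · intro x hx y hy hxy
    rw [← le_sub_iff_add_le]
    refine csSup_le (hne x hx) ?_
    rintro r ⟨τ, M, hτ, hmem, rfl⟩
    rw [le_sub_iff_add_le]
    -- Append `x` and `y` to `τ`: the last increment is the one wanted, the one into `x` is dropped.
    let σ : ℕ → ℝ := fun i => if i ≤ M then τ i else if i = M + 1 then x else y
    refine le_trans ?_ (le_csSup (hbdd y hy) ⟨σ, M + 2, ?_, ?_, rfl⟩)
    · rw [Finset.sum_range_succ, Finset.sum_range_succ]
      have e : ∀ m ∈ Finset.range M, |f (τ (m + 1)) - f (τ m)| ^ q =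
          |f (σ (m + 1)) - f (σ m)| ^ q := by
        intro m hm
        have := Finset.mem_range.1 hm
        simp only [σ]
        rw [if_pos (by omega), if_pos (by omega)]
      rw [Finset.sum_congr rfl e]
      have e1 : σ (M + 1 + 1) = y := by simp [σ]
      have e2 : σ (M + 1) = x := by simp [σ]
      rw [e1, e2]
      have : 0 ≤ |f x - f (σ M)| ^ q := by positivity
      linarith
    · refine monotone_nat_of_le_succ fun i => ?_
      have h1 := (hmem i).2
      have h2 := hτ (Nat.le_succ i)
      simp only [σ]
      split_ifs <;> first | (exfalso; omega) | exact h2 | exact h1 | exact le_rfl | exact hxy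
    · intro i
      simp only [σ]
      split_ifs
      · exact Icc_subset_Icc_right hxy (hmem i)
      · exact ⟨hx.1, hxy⟩
      · exact ⟨hy.1, le_rfl⟩

/-- Quantise the control instead of `f`: its fibres are ordered, and within one `w` grows by at most
1/A, hence so does |f y − f x|^q. -/
theorem exists_isStep_of_control {f w : ℝ → ℝ} {W q T : ℝ} (hq : 0 < q)
    (hw0 : ∀ x ∈ Icc 0 T, 0 ≤ w x ∧ w x ≤ W)
    (hw : ∀ x ∈ Icc 0 T, ∀ y ∈ Icc 0 T, x ≤ y → w x + |f y - f x| ^ q ≤ w y) {A : ℝ} (hA : 0 < A) :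
    ∃ g, IsStep T ⌊W * A⌋₊ g ∧ ∀ x ∈ Icc 0 T, |f x - g x| ≤ (1 / A) ^ (1 / q) := by
  have main : ∀ x ∈ Icc 0 T, ∀ y ∈ Icc 0 T, x ≤ y → ⌊w x * A⌋₊ = ⌊w y * A⌋₊ →
      |f y - f x| ≤ (1 / A) ^ (1 / q) := by
    intro x hx y hy hxy e
    have h1 := hw x hx y hy hxy
    have h2 := Nat.floor_le (mul_nonneg (hw0 x hx).1 hA.le)
    have h3 := Nat.lt_floor_add_one (w y * A)
    rw [← e] at h3
    have h4 : |f y - f x| ^ q ≤ 1 / A := by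
      rw [le_div_iff₀ hA]
      nlinarith
    have h5 := Real.rpow_le_rpow (by positivity) h4 (one_div_nonneg.2 hq.le)
    rwa [← Real.rpow_mul (abs_nonneg _), mul_one_div_cancel hq.ne', Real.rpow_one] at h5
  refine exists_isStep_of_fiber (fun x => ⌊w x * A⌋₊) (fun x hx y hy hxy => ?_) (fun x hx => ?_)
    fun x hx y hy e => ?_
  · refine Nat.floor_le_floor (mul_le_mul_of_nonneg_right ?_ hA.le)
    have := hw x hx y hy hxy
    have : 0 ≤ |f y - f x| ^ q := by positivity
    linarith
  · exact Nat.floor_le_floor (mul_le_mul_of_nonneg_right (hw0 x hx).2 hA.le)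
  · rcases le_total x y with h | h
    · rw [abs_sub_comm]; exact main x hx y hy h e
    · exact main y hy x hx h e.symm

/-- For p = 1 the number of levels enters with exponent 0, so only the errors must be summable. -/
theorem nonempty_stepApprox_of_regulated {f : ℝ → ℝ} {T : ℝ} (hf : IsRegulatedOn f 0 T) :
    Nonempty (StepApprox 1 T f) := by
  choose N g hg hfg using fun k : ℕ =>
    hf.exists_isStep (show (0 : ℝ) < (1 / 2) ^ k by positivity)
  refine ⟨⟨g, N, fun k => (1 / 2) ^ k, hg, hfg,
    tendsto_pow_atTop_nhds_zero_of_lt_one (by norm_num) (by norm_num), fun k => by positivity, ?_⟩⟩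
  have hs : Summable fun k : ℕ => (1 / 2 : ℝ) ^ k :=
    summable_geometric_of_lt_one (by norm_num) (by norm_num)
  simpa using hs.add ((summable_nat_add_iff 1).2 hs)

theorem nonempty_stepApprox_of_pVar {f : ℝ → ℝ} {p q T : ℝ} (hp : 1 < p) (hq1 : 1 ≤ q)
    (hq : q < p / (p - 1)) (hf : pVar q f 0 T < ∞) : Nonempty (StepApprox p T f) := by
  have hq0 : 0 < q := by linarith
  obtain ⟨w, W, hW, hw0, hw⟩ := exists_control hq0 hf
  choose g hg hfg using fun k : ℕ =>
    exists_isStep_of_control hq0 hw0 hw (show (0 : ℝ) < 2 ^ k by positivity)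
  set α := 1 - 1 / p with hα
  have hα0 : 0 < α := by
    rw [hα, sub_pos, div_lt_one (by linarith)]; exact hp
  -- The hypothesis q < p/(p−1) in the form that makes the ratio 2^(α − 1/q) less than 1.
  have hαq : α < 1 / q := by
    rw [lt_div_iff₀ hq0]
    rw [lt_div_iff₀ (by linarith)] at hq
    have : α * p = p - 1 := by rw [hα]; field_simp
    nlinarith
  let ρ : ℝ := (1 / 2 : ℝ) ^ (1 / q)
  have hρ0 : 0 ≤ ρ := by positivity
  have hρ1 : ρ < 1 := Real.rpow_lt_one (by norm_num) (by norm_num) (by positivity)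
  have he : ∀ k : ℕ, (1 / 2 ^ k : ℝ) ^ (1 / q) = ρ ^ k := by
    intro k
    rw [← one_div_pow, ← Real.rpow_natCast, ← Real.rpow_natCast, ← Real.rpow_mul (by norm_num),
      ← Real.rpow_mul (by norm_num), mul_comm]
  refine ⟨⟨g, fun k => ⌊W * 2 ^ k⌋₊, fun k => ρ ^ k, hg, fun k x hx => he k ▸ hfg k x hx,
    tendsto_pow_atTop_nhds_zero_of_lt_one hρ0 hρ1, fun k => by positivity, ?_⟩⟩
  have hr1 : ρ * 2 ^ α < 1 := by
    have : ρ = 2 ^ (-(1 / q)) := by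
      rw [Real.rpow_neg (by norm_num), ← Real.inv_rpow (by norm_num)]; norm_num [ρ]
    rw [this, ← Real.rpow_add (by norm_num)]
    exact Real.rpow_lt_one_of_one_lt_of_neg (by norm_num) (by linarith)
  have hs : Summable fun k : ℕ => (2 * (3 * W + 1) ^ α) * (ρ * 2 ^ α) ^ k :=
    (summable_geometric_of_lt_one (by positivity) hr1).mul_left _
  refine Summable.of_nonneg_of_le (fun k => by positivity) (fun k => ?_) hs
  have h1 : ρ ^ k + ρ ^ (k + 1) ≤ 2 * ρ ^ k := by
    have : ρ ^ (k + 1) ≤ ρ ^ k := pow_le_pow_of_le_one hρ0 hρ1.le (Nat.le_succ k)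
    linarith
  -- 2W + W from the two level counts, and 1 ≤ 2^k for the additional block.
  have h2 : ((⌊W * 2 ^ (k + 1)⌋₊ + ⌊W * 2 ^ k⌋₊ + 1 : ℕ) : ℝ) ≤ (3 * W + 1) * 2 ^ k := by
    push_cast
    have a1 := Nat.floor_le (show 0 ≤ W * 2 ^ (k + 1) by positivity)
    have a2 := Nat.floor_le (show 0 ≤ W * 2 ^ k by positivity)
    have a3 : (1 : ℝ) ≤ 2 ^ k := one_le_pow₀ (by norm_num)
    rw [pow_succ] at a1 ⊢
    linarith
  have h3 := Real.rpow_le_rpow (by positivity) h2 hα0.le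
  have h4 : ((2 : ℝ) ^ k) ^ α = (2 ^ α) ^ k := by
    rw [← Real.rpow_natCast, ← Real.rpow_natCast, ← Real.rpow_mul (by norm_num),
      ← Real.rpow_mul (by norm_num), mul_comm]
  rw [Real.mul_rpow (by positivity) (by positivity), h4] at h3
  calc _ ≤ (2 * ρ ^ k) * ((3 * W + 1) ^ α * (2 ^ α) ^ k) := by gcongr
    _ = _ := by rw [mul_pow]; ring

theorem nonempty_stepApprox {f : ℝ → ℝ} {p T : ℝ} {q : ℝ≥0∞} (hq : q ∈ Q p)
    (hf : MemW q f 0 T) : Nonempty (StepApprox p T f) := by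
  rcases hq with ⟨rfl, rfl⟩ | ⟨hp, hq1, hq⟩
  · rcases hf with ⟨-, h⟩ | ⟨h, -⟩
    · exact nonempty_stepApprox_of_regulated h
    · exact absurd rfl h
  · rcases hf with ⟨rfl, -⟩ | ⟨hqt, h⟩
    · exact absurd hq (not_lt.2 le_top)
    · refine nonempty_stepApprox_of_pVar hp ?_ ?_ h
      · simpa using ENNReal.toReal_mono hqt hq1
      · exact (ENNReal.lt_ofReal_iff_toReal_lt hqt).1 hq

end Approximation

/-! ### Second order processes as curves in L² -/

section L2

variable {Ω : Type*} [MeasurableSpace Ω] {μ : Measure Ω}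

/-- A second order process as a curve in `L²`, extended by zero outside `[0, T]`. -/
noncomputable def curve (X : ℝ → Ω → ℝ) (μ : Measure Ω) (T : ℝ) (hX : IsSecondOrder X μ T)
    (t : ℝ) : Lp ℝ 2 μ :=
  open Classical in if h : t ∈ Icc 0 T then (hX t h).toLp (X t) else 0

theorem curve_ae {X : ℝ → Ω → ℝ} {T : ℝ} (hX : IsSecondOrder X μ T) {t : ℝ} (ht : t ∈ Icc 0 T) :
    curve X μ T hX t =ᵐ[μ] X t := by
  rw [curve, dif_pos ht]; exact MemLp.coeFn_toLp _

theorem inner_curve {X : ℝ → Ω → ℝ} {T : ℝ} (hX : IsSecondOrder X μ T) {s t : ℝ}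
    (hs : s ∈ Icc 0 T) (ht : t ∈ Icc 0 T) :
    inner ℝ (curve X μ T hX s) (curve X μ T hX t) = covFun X μ s t := by
  rw [L2.inner_def, covFun]
  refine integral_congr_ae ?_
  filter_upwards [curve_ae hX hs, curve_ae hX ht] with ω h1 h2
  rw [h1, h2]
  simp [mul_comm]

theorem pVar₂_congr {p : ℝ} {G G' : ℝ → ℝ → ℝ} {a b : ℝ}
    (h : ∀ s ∈ Icc a b, ∀ t ∈ Icc a b, G s t = G' s t) :
    pVar₂ p G a b a b = pVar₂ p G' a b a b := by
  unfold pVar₂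
  refine iSup_congr fun κ => iSup_congr fun η => ?_
  have hκ : ∀ i, κ.pt i ∈ Icc a b := fun i =>
    ⟨κ.pt_first.symm.trans_le (κ.strictMono.monotone (Fin.zero_le i)),
      (κ.strictMono.monotone (Fin.le_last i)).trans_eq κ.pt_last⟩
  have hη : ∀ i, η.pt i ∈ Icc a b := fun i =>
    ⟨η.pt_first.symm.trans_le (η.strictMono.monotone (Fin.zero_le i)),
      (η.strictMono.monotone (Fin.le_last i)).trans_eq η.pt_last⟩
  simp only [doubleIncrement, h _ (hκ _) _ (hη _)]

/-- ‖Y s − Y t‖² = Γ(s,s) − 2Γ(s,t) + Γ(t,t), which is continuous in `s` and vanishes at s = t. -/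
theorem continuousOn_curve {X : ℝ → Ω → ℝ} {T : ℝ} (hX : IsSecondOrder X μ T)
    (hc : ContinuousOn (fun z : ℝ × ℝ => covFun X μ z.1 z.2) (Icc 0 T ×ˢ Icc 0 T)) :
    ContinuousOn (curve X μ T hX) (Icc 0 T) := by
  intro t ht
  rw [ContinuousWithinAt, tendsto_iff_norm_sub_tendsto_zero]
  have hdiag : ContinuousOn (fun s => covFun X μ s s - 2 * covFun X μ s t + covFun X μ t t)
      (Icc 0 T) := by
    have h1 : ContinuousOn (fun s => covFun X μ s s) (Icc 0 T) :=
      hc.comp (f := fun s => (s, s)) (by fun_prop) fun s hs => ⟨hs, hs⟩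
    have h2 : ContinuousOn (fun s => covFun X μ s t) (Icc 0 T) :=
      hc.comp (f := fun s => (s, t)) (by fun_prop) fun s hs => ⟨hs, ht⟩
    fun_prop
  have hlim := (hdiag t ht).tendsto
  have e : covFun X μ t t - 2 * covFun X μ t t + covFun X μ t t = 0 := by ring
  rw [e] at hlim
  have hsq := hlim.sqrt
  rw [Real.sqrt_zero] at hsq
  refine hsq.congr' ?_
  filter_upwards [self_mem_nhdsWithin] with s hs
  rw [← inner_curve hX hs hs, ← inner_curve hX hs ht, ← inner_curve hX ht ht,
    real_inner_self_eq_norm_sq, real_inner_self_eq_norm_sq, ← norm_sub_sq_real,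
    Real.sqrt_sq (norm_nonneg _)]

theorem vecSum_curve_ae {X : ℝ → Ω → ℝ} {T : ℝ} (hX : IsSecondOrder X μ T) (f : ℝ → ℝ) {a b : ℝ}
    (ha : 0 ≤ a) (hb : b ≤ T) (κ : TaggedIntervalPartition a b) :
    (vecSum f (curve X μ T hX) κ : Lp ℝ 2 μ) =ᵐ[μ] rsSum f X κ := by
  have h1 : ∀ n, (∑ i ∈ Finset.range n, f (κ.tagSeq i) •
      (curve X μ T hX (κ.seq (i + 1)) - curve X μ T hX (κ.seq i)) : Lp ℝ 2 μ) =ᵐ[μ]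
      fun ω => ∑ i ∈ Finset.range n, f (κ.tagSeq i) * (X (κ.seq (i + 1)) ω - X (κ.seq i) ω) := by
    intro n
    induction n with
    | zero => simp only [Finset.range_zero, Finset.sum_empty]; exact Lp.coeFn_zero ℝ 2 μ
    | succ n ih =>
      rw [Finset.sum_range_succ]
      have m1 := Icc_subset_Icc ha hb (κ.seq_mem (n + 1))
      have m2 := Icc_subset_Icc ha hb (κ.seq_mem n)
      filter_upwards [ih, Lp.coeFn_add (∑ i ∈ Finset.range n, f (κ.tagSeq i) •
        (curve X μ T hX (κ.seq (i + 1)) - curve X μ T hX (κ.seq i))) (f (κ.tagSeq n) •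
        (curve X μ T hX (κ.seq (n + 1)) - curve X μ T hX (κ.seq n))),
        Lp.coeFn_smul (f (κ.tagSeq n))
          (curve X μ T hX (κ.seq (n + 1)) - curve X μ T hX (κ.seq n)),
        Lp.coeFn_sub (curve X μ T hX (κ.seq (n + 1))) (curve X μ T hX (κ.seq n)),
        curve_ae hX m1, curve_ae hX m2] with ω e1 e2 e3 e4 e5 e6
      rw [e2, Pi.add_apply, e1, e3, Pi.smul_apply, e4, Pi.sub_apply, e5, e6,
        Finset.sum_range_succ, smul_eq_mul]
  refine (h1 κ.n).trans (Eventually.of_forall fun ω => ?_)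
  simp only [rsSum, Finset.sum_range, κ.seq_castSucc, κ.seq_succ]
  exact Finset.sum_congr rfl fun i _ => by simp [TaggedIntervalPartition.tagSeq]

theorem norm_sq_eq_integral (g : Lp ℝ 2 μ) {h : Ω → ℝ} (hgh : g =ᵐ[μ] h) :
    ‖g‖ ^ 2 = ∫ ω, h ω ^ 2 ∂μ := by
  rw [← real_inner_self_eq_norm_sq, L2.inner_def]
  refine integral_congr_ae ?_
  filter_upwards [hgh] with ω e
  rw [e]
  simp [sq]

/-- The mean square error is the squared L² distance, so the definition is convergence in L² as the
mesh tends to 0. -/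
theorem hasQMIntegral_iff {X : ℝ → Ω → ℝ} {T : ℝ} (hX : IsSecondOrder X μ T) (f : ℝ → ℝ) {a b : ℝ}
    (ha : 0 ≤ a) (hb : b ≤ T) {I : Ω → ℝ} (hI : MemLp I 2 μ) :
    HasQMIntegral f X μ a b I ↔
      Tendsto (vecSum f (curve X μ T hX)) (meshFilter a b) (𝓝 (hI.toLp I)) := by
  have e : ∀ κ : TaggedIntervalPartition a b, ∫ ω, (rsSum f X κ ω - I ω) ^ 2 ∂μ =
      dist (vecSum f (curve X μ T hX) κ) (hI.toLp I) ^ 2 := by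
    intro κ
    rw [dist_eq_norm]
    refine (norm_sq_eq_integral _ ?_).symm
    filter_upwards [Lp.coeFn_sub (vecSum f (curve X μ T hX) κ) (hI.toLp I),
      vecSum_curve_ae hX f ha hb κ, hI.coeFn_toLp] with ω e1 e2 e3
    rw [e1, Pi.sub_apply, e2, e3]
  rw [HasQMIntegral, (hasBasis_meshFilter a b).tendsto_iff Metric.nhds_basis_ball]
  simp only [hI, true_and, e, mem_ofPred_eq, Metric.mem_ball]
  constructor
  · intro h ε hε
    obtain ⟨δ, hδ, h⟩ := h (ε ^ 2) (by positivity)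
    exact ⟨δ, hδ, fun κ hκ => lt_of_pow_lt_pow_left₀ 2 hε.le (h κ hκ)⟩
  · intro h ε hε
    obtain ⟨δ, hδ, h⟩ := h (√ε) (Real.sqrt_pos.2 hε)
    exact ⟨δ, hδ, fun κ hκ => (Real.lt_sqrt dist_nonneg).1 (h κ hκ)⟩

end L2

end QMStieltjes

/-! ### Existence and the bound for second order processes -/

theorem theorem2p5 (T : ℝ) (hT : 0 < T) (p : ℝ) (hp : 1 ≤ p) (f : ℝ → ℝ)
    (q : ℝ≥0∞) (hq : q ∈ QMStieltjes.Q p) (hf : QMStieltjes.MemW q f 0 T) :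
    ∃ K : ℝ, ∀ (Ω : Type*) [MeasurableSpace Ω] (μ : Measure Ω) [IsProbabilityMeasure μ]
      (X : ℝ → Ω → ℝ),
      QMStieltjes.IsSecondOrder X μ T →
      ContinuousOn (fun z : ℝ × ℝ => QMStieltjes.covFun X μ z.1 z.2) (Icc 0 T ×ˢ Icc 0 T) →
      QMStieltjes.pVar₂ p (QMStieltjes.covFun X μ) 0 T 0 T < ∞ →
      (∀ t ∈ Icc 0 T, ∃ I : Ω → ℝ, QMStieltjes.HasQMIntegral f X μ 0 t I) ∧
      (∀ s t : ℝ, 0 ≤ s → s < t → t ≤ T →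
        (∃ I : Ω → ℝ, QMStieltjes.HasQMIntegral f X μ s t I) ∧
        ∀ I : Ω → ℝ, QMStieltjes.HasQMIntegral f X μ s t I →
          ∫ ω, I ω ^ 2 ∂μ ≤
            K * (QMStieltjes.pVar₂ p (QMStieltjes.covFun X μ) s t s t).toReal) := by
  obtain ⟨A⟩ := QMStieltjes.nonempty_stepApprox hq hf
  obtain ⟨K, hK⟩ := A.exists_bound hp
  -- Squared because `K` bounds the norm, against the square root of the covariance variation.
  refine ⟨K ^ 2, fun Ω _ μ _ X hX hc hV => ?_⟩
  have hcov : ∀ {s t : ℝ}, 0 ≤ s → t ≤ T →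
      QMStieltjes.pVar₂ p (fun u v => inner ℝ (QMStieltjes.curve X μ T hX u)
        (QMStieltjes.curve X μ T hX v)) s t s t =
      QMStieltjes.pVar₂ p (QMStieltjes.covFun X μ) s t s t := fun hs ht =>
    QMStieltjes.pVar₂_congr fun u hu v hv =>
      QMStieltjes.inner_curve hX (Icc_subset_Icc hs ht hu) (Icc_subset_Icc hs ht hv)
  have hfin : ∀ {s t : ℝ}, 0 ≤ s → t ≤ T →
      QMStieltjes.pVar₂ p (fun u v => inner ℝ (QMStieltjes.curve X μ T hX u)
        (QMStieltjes.curve X μ T hX v)) s t s t < ∞ := fun hs ht => by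
    rw [hcov hs ht]
    exact (QMStieltjes.pVar₂_mono (by linarith) _ hs ht).trans_lt hV
  have hex : ∀ s t : ℝ, 0 ≤ s → s ≤ t → t ≤ T →
      ∃ I : Ω → ℝ, QMStieltjes.HasQMIntegral f X μ s t I := by
    intro s t hs hst ht
    obtain ⟨I, hI⟩ := A.exists_tendsto hp (QMStieltjes.continuousOn_curve hX hc) hs hst ht
      (hfin hs ht)
    refine ⟨I, (QMStieltjes.hasQMIntegral_iff hX f hs ht (Lp.memLp I)).2 ?_⟩
    rwa [Lp.toLp_coeFn]
  refine ⟨fun t ht => hex 0 t le_rfl ht.1 ht.2, fun s t hs hst ht =>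
    ⟨hex s t hs hst.le ht, fun I hI => ?_⟩⟩
  have hlim := (QMStieltjes.hasQMIntegral_iff hX f hs ht hI.1).1 hI
  have := QMStieltjes.meshFilter_neBot hst.le
  -- The uniform bound on the sums passes to any limit, so it holds for every version of the
  -- integral.
  have hle := le_of_tendsto hlim.norm (Eventually.of_forall fun κ =>
    hK (QMStieltjes.curve X μ T hX) hs ht (hfin hs ht) κ)
  rw [← QMStieltjes.norm_sq_eq_integral _ hI.1.coeFn_toLp, ← hcov hs ht]
  refine (pow_le_pow_left₀ (norm_nonneg _) hle 2).trans_eq ?_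
  rw [mul_pow, QMStieltjes.covVar, Real.sq_sqrt ENNReal.toReal_nonneg, mul_comm]
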